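/- **Setting.** Let $\mathcal H$ be a complex Hilbert space and $\Lambda$ a set of sites. For $i,j\in\Lambda$ let $B^i_j$ be bounded operators on $\mathcal H$ with $\sum_i B^{i*}_jB^i_j=\mathbf 1$ (strongly) for each $j$. Let $(\rho_i)_{i\in\Lambda}$ be positive trace-class operators on $\mathcal H$ with $\sum_i\mathrm{Tr}(\rho_i)=1$. Put $S=\{i\in\Lambda:\rho_i\neq0\}$, let $\mathcal K^\rho$ be the Hilbert space with orthonormal basis $(|i\rangle)_{i\in S}$, and set $M_0=B(\mathcal H\otimes\mathcal K^\rho)$, $\rho=\sum_{i\in S}\rho_i\otimes|i\rangle\langle i|$, $M^i_j=B^i_j\otimes|i\rangle\langle j|$ and $$\varphi_k(x)=\frac{\mathrm{Tr}\big((\rho_k\otimes|k\rangle\langle k|)\,x\big)}{\mathrm{Tr}(\rho_k)}\qquad(k\in S,\ x\in M_0),$$ $$\tilde{\mathcal E}(x\otimes y)=\sum_{i,j\in S}\varphi_j(x)\,(M^i_j)^*\,y\,M^i_j\qquad(x,y\in M_0).$$ Let $\mathcal A^\rho=\bigotimes_{k\in\mathbb Z_+}M_0$ be the infinite (spatial)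 C*-tensor product. A quantum Markov chain (QMC) for $(\rho,\tilde{\mathcal E})$ is a state $\tilde\varphi$ on $\mathcal A^\rho$ such that, for all $n\ge 0$ and $x_0,\dots,x_n\in M_0$, $$\tilde\varphi(x_0\otimes\cdots\otimes x_n)=\mathrm{Tr}\Big(\rho\,\tilde{\mathcal E}\big(x_0\otimes\tilde{\mathcal E}(x_1\otimes\cdots\tilde{\mathcal E}(x_n\otimes\mathbf 1)\cdots)\big)\Big).$$ **Claim.** 1. The series defining $\tilde{\mathcal E}(x\otimes y)$ converges unconditionally in the strong operator topology for all $x,y\in M_0$. 2. If $\tilde\varphi$ is a QMC on $\mathcal A^\rho$ for $(\rho,\tilde{\mathcal E})$, then for all $n\ge0$ and $x_0,\dots,x_n\in M_0$ $$\tilde\varphi(x_0\otimes x_1\otimes\cdots\otimes x_n)=\sum_{i_0,\dots,i_n\in S}\mathrm{Tr}\Big(B^{i_n}_{i_{n-1}}\cdots B^{i_2}_{i_1}B^{i_1}_{i_0}\,\rho_{i_0}\,B^{i_1*}_{i_0}B^{i_2*}_{i_1}\cdots B^{i_n*}_{i_{n-1}}\Big)\,\varphi_{i_0}(x_0)\cdots\varphi_{i_n}(x_n),$$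 where the series converges absolutely. 3. If $B^i_j=0$ whenever $\rho_i=0$ and $\rho_j\ne0$ (in particular if all $\rho_i\neq0$), then $\tilde{\mathcal E}(\mathbf 1\otimes\mathbf 1)=\mathbf 1$, and the same absolutely convergent series equals $\mathrm{Tr}\big(\rho\,\tilde{\mathcal E}(x_0\otimes\tilde{\mathcal E}(x_1\otimes\cdots\tilde{\mathcal E}(x_n\otimes\mathbf 1)\cdots))\big)$ for all $n\ge 0$ and $x_0,\dots,x_n\in M_0$. -/

import Mathlib

open scoped InnerProductSpace ComplexOrder

noncomputable section

namespace OQRW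

/-! ## Trace and strong sums on a Hilbert space -/

section Hilbert

variable (E : Type*) [NormedAddCommGroup E] [InnerProductSpace ℂ E] [CompleteSpace E]

/-- The index set of a fixed orthonormal basis of `E`. -/
def basisIndex : Set E := Classical.choose (exists_hilbertBasis ℂ E)

/-- A fixed orthonormal (Hilbert) basis of `E`. -/
def basis : HilbertBasis (basisIndex E) ℂ E :=
  Classical.choose (Classical.choose_spec (exists_hilbertBasis ℂ E))

variable {E}

/-- `T` is of trace class: `∑ₖ ⟪eₖ, |T| eₖ⟫ < ∞` (the sum does not depend on the basis). -/
def IsTraceClass (T : E →L[ℂ] E) : Prop :=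
  Summable fun k => ⟪basis E k, CFC.abs T (basis E k)⟫_ℂ

/-- The trace `Tr T = ∑ₖ ⟪eₖ, T eₖ⟫`; used for trace-class operators only, for which it converges
absolutely and does not depend on the basis. -/
def trace (T : E →L[ℂ] E) : ℂ := ∑' k, ⟪basis E k, T (basis E k)⟫_ℂ

/-- A family of bounded operators is summable in the strong operator topology. -/
def StronglySummable {ι : Type*} (f : ι → E →L[ℂ] E) : Prop :=
  Summable fun i => ContinuousLinearMap.toPointwiseConvergenceCLM ℂ (RingHom.id ℂ) E E (f i)

/-- The sum of a family of bounded operators in the strong operator topology. -/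
def strongSum {ι : Type*} (f : ι → E →L[ℂ] E) : E →L[ℂ] E :=
  (ContinuousLinearMap.toUniformConvergenceCLM (RingHom.id ℂ) E {s : Set E | Finite s}).symm
    (∑' i, ContinuousLinearMap.toPointwiseConvergenceCLM ℂ (RingHom.id ℂ) E E (f i))

end Hilbert

/-! ## The infinite tensor product `⨂_{k ∈ ℤ₊} B(E)`

Let `κ` index an orthonormal basis `(eₗ)` of `E`. For each `k`, the Hilbert space `ℓ²(ℕ → κ)` is
`ℓ²(({m // m ≠ k} → κ)) ⊗ E`, so that `B(E)` acts on its `k`-th tensor factor. The representations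
`J k` obtained in this way commute for different `k`, and the C⋆-algebra that they generate is the
(spatial) infinite C⋆-tensor product of copies of `B(E)`. -/

section Tensor

variable {E : Type*} [NormedAddCommGroup E] [InnerProductSpace ℂ E] [CompleteSpace E]

/-- The Hilbert direct sum of copies of `E` indexed by `R`, i.e. `ℓ²(R) ⊗ E`. -/
abbrev Copies (R : Type*) (E : Type*) [NormedAddCommGroup E] := lp (fun _ : R => E) 2

theorem hasSum_norm_sq {R E : Type*} [NormedAddCommGroup E] (f : Copies R E) : HasSum (fun r => ‖f r‖ ^ 2) (‖f‖ ^ 2) := by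
  have h := lp.hasSum_norm (p := 2) (by norm_num) f
  simpa using h

theorem memlp_map {R E : Type*} [NormedAddCommGroup E] [InnerProductSpace ℂ E] (x : E →L[ℂ] E) (f : Copies R E) :
    Memℓp (fun r => x (f r)) 2 := by
  refine memℓp_gen ?_
  have h := (hasSum_norm_sq f).summable.mul_left (‖x‖ ^ 2)
  refine Summable.of_nonneg_of_le (fun r => by positivity) (fun r => ?_) h
  simp only [ENNReal.toReal_ofNat, Real.rpow_ofNat]
  rw [← mul_pow]
  gcongr
  exact x.le_opNorm _

/-- The operator `1 ⊗ x` on `ℓ²(R) ⊗ E`. -/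
def ampl (R : Type*) (x : E →L[ℂ] E) : Copies R E →L[ℂ] Copies R E :=
  LinearMap.mkContinuous
    { toFun := fun f => ⟨fun r => x (f r), memlp_map x f⟩
      map_add' := fun f g => by ext r; exact x.map_add (f r) (g r)
      map_smul' := fun c f => by ext r; exact x.map_smul c (f r) }
    ‖x‖ (fun f => by
      refine le_of_sq_le_sq ?_ (by positivity)
      rw [mul_pow]
      refine hasSum_le (fun r => ?_) (hasSum_norm_sq _) ((hasSum_norm_sq f).mul_left (‖x‖ ^ 2))
      rw [← mul_pow]
      gcongr
      exact x.le_opNorm _)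

@[simp] theorem ampl_apply {R : Type*} (x : E →L[ℂ] E) (f : Copies R E) (r : R) :
    ampl R x f r = x (f r) := rfl

/-- `x ↦ 1 ⊗ x` as a unital ⋆-homomorphism. -/
def amplHom (R : Type*) : (E →L[ℂ] E) →⋆ₐ[ℂ] (Copies R E →L[ℂ] Copies R E) where
  toFun := ampl R
  map_one' := by ext f r; simp
  map_mul' x y := by ext f r; simp
  map_zero' := by ext f r; simp
  map_add' x y := by ext f r; simp
  commutes' c := by ext f r; simp [Algebra.algebraMap_eq_smul_one]
  map_star' x := by
    rw [ContinuousLinearMap.star_eq_adjoint, ContinuousLinearMap.star_eq_adjoint,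
      ContinuousLinearMap.eq_adjoint_iff]
    intro f g
    rw [lp.inner_eq_tsum, lp.inner_eq_tsum]
    simp [ContinuousLinearMap.adjoint_inner_left]

/-- The vector of `ℓ²({m // m ≠ k} → κ) ⊗ E` that corresponds to `ω : ℕ → κ`. -/
def factorVec (E : Type*) [NormedAddCommGroup E] [InnerProductSpace ℂ E] [CompleteSpace E]
    (k : ℕ) (ω : ℕ → basisIndex E) : Copies ({m : ℕ // m ≠ k} → basisIndex E) E :=
  open Classical in lp.single 2 (fun m => ω m.1) (basis E (ω k))

theorem factorVec_orthonormal (k : ℕ) : Orthonormal ℂ (factorVec E k) := by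
  classical
  rw [orthonormal_iff_ite]
  intro ω ω'
  have hb := (orthonormal_iff_ite.mp (basis E).orthonormal) (ω k) (ω' k)
  unfold factorVec
  rw [lp.inner_single_left, lp.single_apply]
  by_cases h : ω = ω'
  · subst h
    simpa using hb
  · rw [if_neg h]
    by_cases h' : (fun m : {m : ℕ // m ≠ k} => ω m.1) = fun m => ω' m.1
    · have hk : ω k ≠ ω' k := by
        intro hk
        apply h
        funext m
        by_cases hm : m = k
        · rw [hm, hk]
        · exact congrFun h' ⟨m, hm⟩
      rw [h', Pi.single_eq_same, hb, if_neg hk]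
    · rw [Pi.single_eq_of_ne h', inner_zero_right]

theorem factorVec_complete (k : ℕ) : (Submodule.span ℂ (Set.range (factorVec E k)))ᗮ = ⊥ := by
  classical
  rw [Submodule.eq_bot_iff]
  intro f hf
  ext1
  funext r
  change f r = 0
  apply (basis E).repr.injective
  rw [map_zero]
  ext l
  rw [(basis E).repr_apply_apply]
  let ω : ℕ → basisIndex E := fun m => if h : m = k then l else r ⟨m, h⟩
  have h1 : (fun m : {m : ℕ // m ≠ k} => ω m.1) = r := by
    funext m
    simp [ω, m.2]
  have h2 : ω k = l := by simp [ω]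
  have h := (Submodule.mem_orthogonal _ f).mp hf (factorVec E k ω)
    (Submodule.subset_span ⟨ω, rfl⟩)
  unfold factorVec at h
  rw [lp.inner_single_left, h1, h2] at h
  simpa using h

/-- The unitary `ℓ²({m // m ≠ k} → κ) ⊗ E ≃ ℓ²(ℕ → κ)`. -/
def factorEquiv (E : Type*) [NormedAddCommGroup E] [InnerProductSpace ℂ E] [CompleteSpace E]
    (k : ℕ) : Copies ({m : ℕ // m ≠ k} → basisIndex E) E ≃ₗᵢ[ℂ] Copies (ℕ → basisIndex E) ℂ :=
  (HilbertBasis.mkOfOrthogonalEqBot (factorVec_orthonormal k) (factorVec_complete k)).repr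

/-- The action of `B(E)` on the `k`-th tensor factor. -/
def J (E : Type*) [NormedAddCommGroup E] [InnerProductSpace ℂ E] [CompleteSpace E] (k : ℕ) :
    (E →L[ℂ] E) →⋆ₐ[ℂ] (Copies (ℕ → basisIndex E) ℂ →L[ℂ] Copies (ℕ → basisIndex E) ℂ) :=
  (factorEquiv E k).conjStarAlgEquiv.toStarAlgHom.comp
    (amplHom ({m : ℕ // m ≠ k} → basisIndex E))

/-- The algebra `⨂_{k ∈ ℤ₊} B(E)`: the C⋆-algebra generated by all `J k x`. -/
def tensorAlgebra (E : Type*) [NormedAddCommGroup E] [InnerProductSpace ℂ E] [CompleteSpace E] :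
    StarSubalgebra ℂ (Copies (ℕ → basisIndex E) ℂ →L[ℂ] Copies (ℕ → basisIndex E) ℂ) :=
  (StarAlgebra.adjoin ℂ {a | ∃ k x, J E k x = a}).topologicalClosure

/-- `J k x` as an element of the infinite tensor product. -/
def embed (k : ℕ) (x : E →L[ℂ] E) : tensorAlgebra E :=
  ⟨J E k x, StarSubalgebra.le_topologicalClosure _
    (StarAlgebra.subset_adjoin ℂ _ ⟨k, x, rfl⟩)⟩

/-- `x₀ ⊗ x₁ ⊗ ⋯ ⊗ xₙ = J 0 x₀ * J 1 x₁ * ⋯ * J n xₙ`. -/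
def elemTensor {n : ℕ} (x : Fin (n + 1) → E →L[ℂ] E) : tensorAlgebra E :=
  (List.ofFn fun k : Fin (n + 1) => embed (k : ℕ) (x k)).prod

/-- A state: a linear functional that is positive and normalised. -/
structure IsState (φ : tensorAlgebra E →ₗ[ℂ] ℂ) : Prop where
  nonneg : ∀ a, 0 ≤ φ (star a * a)
  map_one : φ 1 = 1

/-- `𝓔(x₀ ⊗ 𝓔(x₁ ⊗ ⋯ 𝓔(xₙ ⊗ 1) ⋯))`, where `𝓔 x y` stands for `𝓔(x ⊗ y)`. -/
def iterExp (𝓔 : (E →L[ℂ] E) → (E →L[ℂ] E) → (E →L[ℂ] E)) {n : ℕ}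
    (x : Fin (n + 1) → E →L[ℂ] E) : E →L[ℂ] E :=
  (List.ofFn x).foldr 𝓔 1

/-- `φ` is the quantum Markov chain with initial state `φ₀` and transition expectation `𝓔`: it is
a state with `φ(x₀ ⊗ ⋯ ⊗ xₙ) = φ₀(𝓔(x₀ ⊗ 𝓔(x₁ ⊗ ⋯ 𝓔(xₙ ⊗ 1) ⋯)))`. -/
structure IsQMC (φ₀ : (E →L[ℂ] E) → ℂ) (𝓔 : (E →L[ℂ] E) → (E →L[ℂ] E) → (E →L[ℂ] E))
    (φ : tensorAlgebra E →ₗ[ℂ] ℂ) : Prop where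
  isState : IsState φ
  map_tensor : ∀ (n : ℕ) (x : Fin (n + 1) → E →L[ℂ] E), φ (elemTensor x) = φ₀ (iterExp 𝓔 x)

end Tensor

/-! ## Open quantum random walks

`B i j` is the operator `Bⁱⱼ` for the passage from site `j` to site `i`. -/

section Walk

variable {Λ H : Type*} [NormedAddCommGroup H] [InnerProductSpace ℂ H] [CompleteSpace H]

/-- `∑ᵢ Bⁱⱼ* Bⁱⱼ = 1` strongly, for each site `j`. -/
def IsOQRW (B : Λ → Λ → H →L[ℂ] H) : Prop :=
  ∀ (j : Λ) (h : H), HasSum (fun i => (ContinuousLinearMap.adjoint (B i j)) (B i j h)) h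

/-- `∑ᵢ ρᵢ ⊗ |i⟩⟨i|` is a density operator: each `ρᵢ` is positive and of trace class, and
`∑ᵢ Tr ρᵢ = 1`. -/
structure IsBlockDensity (ρ : Λ → H →L[ℂ] H) : Prop where
  pos : ∀ i, (ρ i).IsPositive
  traceClass : ∀ i, IsTraceClass (ρ i)
  hasSum_trace : HasSum (fun i => trace (ρ i)) 1

/-- The sites `i` with `ρᵢ ≠ 0`. -/
abbrev Supp (ρ : Λ → H →L[ℂ] H) := {i : Λ // ρ i ≠ 0}

/-- The Hilbert space `H ⊗ 𝒦^ρ`, where `𝒦^ρ` has the orthonormal basis `|i⟩`, `ρᵢ ≠ 0`; it is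
realised as `ℓ²(Supp ρ; H)`, with `h ⊗ |i⟩` the vector `h` placed at `i`. -/
abbrev Space (ρ : Λ → H →L[ℂ] H) := Copies (Supp ρ) H

/-- The operator `a ⊗ |i⟩⟨j|` on `H ⊗ 𝒦^ρ`. -/
def siteOp (ρ : Λ → H →L[ℂ] H) (i j : Supp ρ) (a : H →L[ℂ] H) : Space ρ →L[ℂ] Space ρ :=
  open Classical in
  (lp.singleContinuousLinearMap ℂ (fun _ : Supp ρ => H) 2 i) ∘L a ∘L
    (lp.evalCLM ℂ (fun _ : Supp ρ => H) 2 j)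

/-- The density operator `ρ = ∑ᵢ ρᵢ ⊗ |i⟩⟨i|`. -/
def density (ρ : Λ → H →L[ℂ] H) : Space ρ →L[ℂ] Space ρ := ∑' i : Supp ρ, siteOp ρ i i (ρ i)

/-- The initial state `x ↦ Tr(ρ x)`. -/
def initState (ρ : Λ → H →L[ℂ] H) (x : Space ρ →L[ℂ] Space ρ) : ℂ := trace (density ρ * x)

/-- `φₖ(x) = Tr((ρₖ ⊗ |k⟩⟨k|) x) / Tr(ρₖ)`. -/
def localState (ρ : Λ → H →L[ℂ] H) (k : Supp ρ) (x : Space ρ →L[ℂ] Space ρ) : ℂ :=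
  trace (siteOp ρ k k (ρ k) * x) / trace (ρ k)

/-- `Mⁱⱼ = Bⁱⱼ ⊗ |i⟩⟨j|`. -/
def M (B : Λ → Λ → H →L[ℂ] H) (ρ : Λ → H →L[ℂ] H) (i j : Supp ρ) : Space ρ →L[ℂ] Space ρ :=
  siteOp ρ i j (B i j)

/-- The terms `φⱼ(x) Mⁱⱼ* y Mⁱⱼ`, `p = (i, j)`, of the series for `Ẽ(x ⊗ y)`. Sites `i` with
`ρᵢ = 0` contribute nothing, since `y` lives on `H ⊗ 𝒦^ρ`. -/
def transTerm (B : Λ → Λ → H →L[ℂ] H) (ρ : Λ → H →L[ℂ] H) (x y : Space ρ →L[ℂ] Space ρ)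
    (p : Supp ρ × Supp ρ) : Space ρ →L[ℂ] Space ρ :=
  localState ρ p.2 x • (star (M B ρ p.1 p.2) * y * M B ρ p.1 p.2)

/-- The transition expectation
`Ẽ(x ⊗ y) = ∑_{i,j} (Tr((ρⱼ ⊗ |j⟩⟨j|) x) / Tr(ρⱼ)) Mⁱⱼ* y Mⁱⱼ` (strong sum). -/
def transExp (B : Λ → Λ → H →L[ℂ] H) (ρ : Λ → H →L[ℂ] H) (x y : Space ρ →L[ℂ] Space ρ) :
    Space ρ →L[ℂ] Space ρ :=
  strongSum (transTerm B ρ x y)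

/-- The product `B^{iₙ}_{iₙ₋₁} ⋯ B^{i₂}_{i₁} B^{i₁}_{i₀}` along a path (`1` for `n = 0`). -/
def pathOp (B : Λ → Λ → H →L[ℂ] H) : (n : ℕ) → (Fin (n + 1) → Λ) → H →L[ℂ] H
  | 0, _ => 1
  | n + 1, i => B (i (Fin.last (n + 1))) (i (Fin.last n).castSucc) *
      pathOp B n (fun k => i k.castSucc)

/-- The summand
`Tr(B^{iₙ}_{iₙ₋₁} ⋯ B^{i₁}_{i₀} ρ_{i₀} B^{i₁}_{i₀}* ⋯ B^{iₙ}_{iₙ₋₁}*) φ_{i₀}(x₀) ⋯ φ_{iₙ}(xₙ)`. -/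
def pathTerm (B : Λ → Λ → H →L[ℂ] H) (ρ : Λ → H →L[ℂ] H) {n : ℕ}
    (x : Fin (n + 1) → Space ρ →L[ℂ] Space ρ) (i : Fin (n + 1) → Supp ρ) : ℂ :=
  trace (pathOp B n (fun k => (i k : Λ)) * ρ (i 0) * star (pathOp B n (fun k => (i k : Λ)))) *
    ∏ k, localState ρ (i k) (x k)

end Walk

end OQRW

end

noncomputable section

namespace OQRW

/-! Each trace is replaced by a sum over vectors. A positive trace-class `T` is `∑ |w⟩⟨w|` with `w =
√T eₖ` and `∑ ‖w‖² = Tr T`, whence `Tr (T x) = ∑ ⟪w, x w⟫` for every bounded `x`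
(`Resolves.hasSum_trace`). This treats `initState`, `localState` and the path traces alike.

For a vector `v ⊗ |j⟩`, iterating `Ẽ` gives a sum over paths from `j` of `‖P v‖²` times local
states, where `P` is the path operator (`hasSum_inner_foldr`). Since the innermost argument is `1`,
a path has one more site than there are factors `x`, and its last site carries no local state. With
`n + 1` factors, the claimed formula therefore amounts to summing out the last of `n + 2` sites and
recovering the weight of the shorter path: this is `Conserves`.

Since sums run only over sites with `ρᵢ ≠ 0`, in general only `≤` holds: mass may leak to the other
sites. If `Bⁱⱼ = 0` for such leaks, equality is immediate (`conserves_of_invariant`). If a QMC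
exists, normalisation makes the total weight `1` for every length; the leaks are nonnegative with
sum `0`, so each vanishes (`conserves_of_total`). -/

theorem summable_prod_of_fiber_le {α β : Type*} {g : α × β → ℝ} {h : α → ℝ} (hg : ∀ p, 0 ≤ g p)
    (hs : ∀ a, Summable fun b => g (a, b)) (hle : ∀ a, ∑' b, g (a, b) ≤ h a) (hh : Summable h) :
    Summable g ∧ ∑' p, g p ≤ ∑' a, h a := by
  have hf : Summable fun a => ∑' b, g (a, b) :=
    Summable.of_nonneg_of_le (fun a => tsum_nonneg fun b => hg _) hle hh
  have hsum : Summable g := (summable_prod_of_nonneg hg).2 ⟨hs, hf⟩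
  refine ⟨hsum, ?_⟩
  rw [hsum.tsum_prod]
  exact hf.tsum_le_tsum hle hh

/-! ### Resolutions of trace-class operators into rank-one operators -/

section Resolution

variable {E F ι : Type*} [NormedAddCommGroup E] [InnerProductSpace ℂ E] [CompleteSpace E]
  [NormedAddCommGroup F] [InnerProductSpace ℂ F] [CompleteSpace F]

/-- `T = ∑ₚ |wₚ⟩⟨wₚ|` weakly, where `∑ₚ ‖wₚ‖² < ∞`. -/
structure Resolves (w : ι → E) (T : E →L[ℂ] E) : Prop where
  summable : Summable fun p => ‖w p‖ ^ 2
  hasSum : ∀ f g, HasSum (fun p => ⟪g, w p⟫_ℂ * ⟪w p, f⟫_ℂ) ⟪g, T f⟫_ℂ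

omit [CompleteSpace E] in
theorem hasSum_norm_inner_sq {κ : Type*} (b : HilbertBasis κ ℂ E) (v : E) :
    HasSum (fun k => ‖⟪v, b k⟫_ℂ‖ ^ 2) (‖v‖ ^ 2) := by
  have h := b.hasSum_inner_mul_inner v v
  rw [inner_self_eq_norm_sq_to_K] at h
  have h2 := Complex.hasSum_re h
  convert h2 using 1
  · funext k
    rw [← inner_conj_symm (b k) v, RCLike.mul_conj]
    norm_cast
  · norm_cast

/-- The double family `⟪eₖ, w p⟫ ⟪w p, x eₖ⟫` is summed in both orders: over `k` Parseval gives `⟪w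
p, x (w p)⟫`, over `p` the resolution gives `⟪eₖ, T x eₖ⟫`. It is absolutely summable, being bounded
by the squared coefficients of `w p` and `x* (w p)`. -/
theorem Resolves.hasSum_trace {w : ι → E} {T : E →L[ℂ] E} (h : Resolves w T) (x : E →L[ℂ] E) :
    HasSum (fun p => ⟪w p, x (w p)⟫_ℂ) (trace (T * x)) := by
  obtain ⟨y, hyx⟩ : ∃ y : E →L[ℂ] E, ∀ u v, ⟪y u, v⟫_ℂ = ⟪u, x v⟫_ℂ :=
    ⟨ContinuousLinearMap.adjoint x, fun u v => ContinuousLinearMap.adjoint_inner_left x v u⟩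
  have hy : Summable fun p => ‖y (w p)‖ ^ 2 := by
    refine Summable.of_nonneg_of_le (fun p => by positivity) (fun p => ?_)
      (h.summable.mul_left (‖y‖ ^ 2))
    rw [← mul_pow]
    gcongr
    exact y.le_opNorm _
  have hg (p : ι) : HasSum
      (fun k => ‖⟪w p, basis E k⟫_ℂ‖ ^ 2 + ‖⟪y (w p), basis E k⟫_ℂ‖ ^ 2)
      (‖w p‖ ^ 2 + ‖y (w p)‖ ^ 2) :=
    (hasSum_norm_inner_sq (basis E) (w p)).add (hasSum_norm_inner_sq (basis E) (y (w p)))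
  have hgs := (summable_prod_of_fiber_le
    (g := fun p : ι × basisIndex E =>
      ‖⟪w p.1, basis E p.2⟫_ℂ‖ ^ 2 + ‖⟪y (w p.1), basis E p.2⟫_ℂ‖ ^ 2)
    (fun p => add_nonneg (sq_nonneg _) (sq_nonneg _))
    (fun p => (hg p).summable) (fun p => (hg p).tsum_eq.le) (h.summable.add hy)).1
  have hG : Summable fun p : ι × basisIndex E =>
      ⟪basis E p.2, w p.1⟫_ℂ * ⟪w p.1, x (basis E p.2)⟫_ℂ := by
    refine Summable.of_norm_bounded hgs fun p => ?_
    rw [norm_mul, ← hyx, norm_inner_symm]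
    nlinarith only [two_mul_le_add_sq ‖⟪w p.1, basis E p.2⟫_ℂ‖ ‖⟪y (w p.1), basis E p.2⟫_ℂ‖,
      sq_nonneg ‖⟪w p.1, basis E p.2⟫_ℂ‖, sq_nonneg ‖⟪y (w p.1), basis E p.2⟫_ℂ‖]
  have h1 := hG.hasSum.prod_fiberwise (g := fun p => ⟪w p, x (w p)⟫_ℂ) fun p => by
    rw [← hyx]
    refine ((basis E).hasSum_inner_mul_inner (y (w p)) (w p)).congr_fun fun k => ?_
    rw [hyx, mul_comm]
  have h2 := (((Equiv.prodComm (basisIndex E) ι).hasSum_iff).2 hG.hasSum).prod_fiberwise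
    (g := fun k => ⟪basis E k, T (x (basis E k))⟫_ℂ) fun k => h.hasSum (x (basis E k)) (basis E k)
  have h3 : trace (T * x) = _ := h2.tsum_eq
  rwa [h3]

theorem Resolves.map {w : ι → E} {T : E →L[ℂ] E} (h : Resolves w T) (A : E →L[ℂ] F) :
    Resolves (fun p => A (w p)) (A ∘L T ∘L ContinuousLinearMap.adjoint A) where
  summable := by
    refine Summable.of_nonneg_of_le (fun p => by positivity) (fun p => ?_)
      (h.summable.mul_left (‖A‖ ^ 2))
    rw [← mul_pow]
    gcongr
    exact A.le_opNorm _
  hasSum f g := by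
    simpa [ContinuousLinearMap.adjoint_inner_left, ContinuousLinearMap.adjoint_inner_right] using
      h.hasSum (ContinuousLinearMap.adjoint A f) (ContinuousLinearMap.adjoint A g)

theorem Resolves.hasSum_norm_sq {w : ι → E} {T : E →L[ℂ] E} (h : Resolves w T) :
    HasSum (fun p => ((‖w p‖ ^ 2 : ℝ) : ℂ)) (trace T) := by
  have := h.hasSum_trace 1
  rw [mul_one] at this
  refine this.congr_fun fun p => ?_
  simp [inner_self_eq_norm_sq_to_K]

omit [CompleteSpace E] in
-- Cauchy–Schwarz in each term, against unit vectors. It serves to show that `ρₖ ≠ 0` has nonzero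
-- trace and that the series for `density` converges in norm.
theorem Resolves.norm_le {w : ι → E} {T : E →L[ℂ] E} (h : Resolves w T) :
    ‖T‖ ≤ ∑' p, ‖w p‖ ^ 2 := by
  refine ContinuousLinearMap.opNorm_le_of_re_inner_le (tsum_nonneg fun p => by positivity)
    fun f g hf hg => ?_
  have hle (p : ι) : ‖⟪g, w p⟫_ℂ * ⟪w p, f⟫_ℂ‖ ≤ ‖w p‖ ^ 2 := by
    have h1 := norm_inner_le_norm (𝕜 := ℂ) g (w p)
    have h2 := norm_inner_le_norm (𝕜 := ℂ) (w p) f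
    rw [hf, mul_one] at h2
    rw [hg, one_mul] at h1
    rw [norm_mul, sq]
    gcongr
  have h3 := tsum_of_norm_bounded h.summable.hasSum hle
  rw [(h.hasSum f g).tsum_eq] at h3
  rw [inner_re_symm]
  exact (RCLike.re_le_norm _).trans h3

/-- Parseval for `⟪√T g, √T f⟫ = ⟪g, T f⟫`. -/
theorem resolves_sqrt {T : E →L[ℂ] E} (hT : T.IsPositive) (htc : IsTraceClass T) :
    Resolves (fun k => CFC.sqrt T (basis E k)) T := by
  have h0 : 0 ≤ T := (ContinuousLinearMap.nonneg_iff_isPositive T).2 hT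
  have hss : CFC.sqrt T * CFC.sqrt T = T := CFC.sqrt_mul_sqrt_self T
  have hsa : ∀ u v : E, ⟪CFC.sqrt T u, v⟫_ℂ = ⟪u, CFC.sqrt T v⟫_ℂ := by
    have := ((ContinuousLinearMap.nonneg_iff_isPositive _).1 (CFC.sqrt_nonneg T)).isSymmetric
    exact fun u v => this u v
  constructor
  · unfold IsTraceClass at htc
    rw [CFC.abs_of_nonneg T h0] at htc
    refine (Complex.hasSum_re htc.hasSum).summable.congr fun k => ?_
    nth_rewrite 1 [← hss]
    rw [mul_apply_eq_comp, ← hsa, inner_self_eq_norm_sq_to_K]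
    norm_cast
  · intro f g
    have := (basis E).hasSum_inner_mul_inner (CFC.sqrt T g) (CFC.sqrt T f)
    rw [hsa, ← mul_apply_eq_comp, hss] at this
    refine this.congr_fun fun k => ?_
    rw [hsa, hsa]

end Resolution

/-! ### Strong convergence of sandwich series -/

section Strong

variable {E ι : Type*} [NormedAddCommGroup E] [InnerProductSpace ℂ E] [CompleteSpace E]

/-- The tails of the vector series are controlled by those of the scalar series `∑ ‖A p f‖²`, which
gives the Cauchy criterion. -/
theorem exists_hasSum_sandwich {A t : ι → E →L[ℂ] E} {C : ℝ}
    (hA : ∀ f, Summable (fun p => ‖A p f‖ ^ 2) ∧ ∑' p, ‖A p f‖ ^ 2 ≤ ‖f‖ ^ 2)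
    (ht : ∀ p, ‖t p‖ ≤ C) :
    ∃ S : E →L[ℂ] E, ∀ f, HasSum (fun p => (star (A p) * t p * A p) f) (S f) := by
  -- Pair the partial sum `u` with itself, apply Cauchy–Schwarz, bound `∑ ‖A p u‖²` by `‖u‖²`, and
  -- cancel `‖u‖²`.
  have key (s : Finset ι) (f : E) :
      ‖∑ p ∈ s, (star (A p) * t p * A p) f‖ ^ 2 ≤ C ^ 2 * ∑ p ∈ s, ‖A p f‖ ^ 2 := by
    set u := ∑ p ∈ s, (star (A p) * t p * A p) f with hu
    have hin : (‖u‖ ^ 2 : ℝ) ≤ ∑ p ∈ s, ‖A p u‖ * (C * ‖A p f‖) := by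
      have : ((‖u‖ ^ 2 : ℝ) : ℂ) = ∑ p ∈ s, ⟪A p u, t p (A p f)⟫_ℂ := by
        have h1 : ((‖u‖ ^ 2 : ℝ) : ℂ) = ⟪u, u⟫_ℂ := by
          rw [inner_self_eq_norm_sq_to_K]; norm_cast
        rw [h1]
        nth_rewrite 2 [hu]
        rw [inner_sum]
        refine Finset.sum_congr rfl fun p _ => ?_
        simp [ContinuousLinearMap.star_eq_adjoint, ContinuousLinearMap.adjoint_inner_right]
      have h2 : (‖u‖ ^ 2 : ℝ) = ‖∑ p ∈ s, ⟪A p u, t p (A p f)⟫_ℂ‖ := by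
        rw [← this, Complex.norm_real, Real.norm_of_nonneg (by positivity)]
      rw [h2]
      refine (norm_sum_le _ _).trans (Finset.sum_le_sum fun p _ => ?_)
      refine (norm_inner_le_norm _ _).trans ?_
      gcongr
      exact (t p).le_of_opNorm_le (ht p) _
    have hcs := Finset.sum_mul_sq_le_sq_mul_sq s (fun p => ‖A p u‖) (fun p => C * ‖A p f‖)
    have hAu : ∑ p ∈ s, ‖A p u‖ ^ 2 ≤ ‖u‖ ^ 2 :=
      ((hA u).1.sum_le_tsum s fun p _ => by positivity).trans (hA u).2
    simp only [mul_pow, ← Finset.mul_sum] at hcs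
    set c := C ^ 2 * ∑ p ∈ s, ‖A p f‖ ^ 2
    have hc : 0 ≤ c := by positivity
    have h4 : (‖u‖ ^ 2) ^ 2 ≤ ‖u‖ ^ 2 * c :=
      (pow_le_pow_left₀ (by positivity) hin 2).trans (hcs.trans (by gcongr))
    rcases eq_or_ne u 0 with h0 | h0
    · simpa [h0] using hc
    · have : 0 < ‖u‖ ^ 2 := by positivity
      rw [sq] at h4
      exact le_of_mul_le_mul_left h4 this
  have hsum (f : E) : Summable fun p => (star (A p) * t p * A p) f := by
    rw [summable_iff_vanishing_norm]
    intro ε hε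
    -- The `+ 1` keeps the denominator positive when `C = 0`.
    obtain ⟨s, hs⟩ := summable_iff_vanishing_norm.1 (hA f).1 (ε ^ 2 / (C ^ 2 + 1)) (by positivity)
    refine ⟨s, fun u hu => ?_⟩
    have h1 := hs u hu
    rw [Real.norm_of_nonneg (by positivity), lt_div_iff₀ (by positivity)] at h1
    refine lt_of_pow_lt_pow_left₀ 2 hε.le ((key u f).trans_lt ?_)
    have : 0 ≤ ∑ p ∈ u, ‖A p f‖ ^ 2 := by positivity
    nlinarith
  -- `|C|` is needed because `C` may be negative when `ι` is empty.
  have hbd (f : E) : ‖∑' p, (star (A p) * t p * A p) f‖ ≤ |C| * ‖f‖ := by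
    refine le_of_tendsto (hsum f).hasSum.norm (Filter.Eventually.of_forall fun s => ?_)
    refine le_of_sq_le_sq ((key s f).trans ?_) (by positivity)
    rw [mul_pow, sq_abs]
    gcongr
    exact ((hA f).1.sum_le_tsum s fun p _ => by positivity).trans (hA f).2
  refine ⟨LinearMap.mkContinuous
    { toFun := fun f => ∑' p, (star (A p) * t p * A p) f
      map_add' := fun f g => by
        simp only [map_add]
        exact (hsum f).tsum_add (hsum g)
      map_smul' := fun c f => by
        simp only [map_smul]
        exact (hsum f).tsum_const_smul c } |C| hbd, fun f => (hsum f).hasSum⟩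

omit [CompleteSpace E] in
theorem hasSum_pointwise {f : ι → E →L[ℂ] E} {S : E →L[ℂ] E}
    (h : ∀ v, HasSum (fun i => f i v) (S v)) :
    HasSum (fun i => ContinuousLinearMap.toPointwiseConvergenceCLM ℂ (RingHom.id ℂ) E E (f i))
      (ContinuousLinearMap.toPointwiseConvergenceCLM ℂ (RingHom.id ℂ) E E S) := by
  unfold HasSum
  rw [PointwiseConvergenceCLM.tendsto_iff_forall_tendsto]
  intro v
  refine (h v).congr fun s => ?_
  rw [← map_sum]
  exact (sum_apply s f v).symm

omit [CompleteSpace E] in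
theorem stronglySummable_of_hasSum {f : ι → E →L[ℂ] E} {S : E →L[ℂ] E}
    (h : ∀ v, HasSum (fun i => f i v) (S v)) : StronglySummable f :=
  (hasSum_pointwise h).summable

omit [CompleteSpace E] in
theorem strongSum_eq {f : ι → E →L[ℂ] E} {S : E →L[ℂ] E}
    (h : ∀ v, HasSum (fun i => f i v) (S v)) : strongSum f = S := by
  unfold strongSum
  rw [(hasSum_pointwise h).tsum_eq]
  rfl

end Strong

/-! ### The vectors `h ⊗ |k⟩` -/

section Site

variable {Λ H : Type*} [NormedAddCommGroup H] [InnerProductSpace ℂ H] {ρ : Λ → H →L[ℂ] H}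

/-- The isometry `h ↦ h ⊗ |k⟩`. -/
def incl (ρ : Λ → H →L[ℂ] H) (k : Supp ρ) : H →L[ℂ] Space ρ :=
  open Classical in lp.singleContinuousLinearMap ℂ (fun _ : Supp ρ => H) 2 k

theorem siteOp_apply (i j : Supp ρ) (a : H →L[ℂ] H) (f : Space ρ) :
    siteOp ρ i j a f = incl ρ i (a (f j)) := rfl

theorem incl_self (k : Supp ρ) (v : H) : (incl ρ k v : Space ρ) k = v := by
  classical
  simp [incl, lp.single_apply]

theorem incl_of_ne {j k : Supp ρ} (h : j ≠ k) (v : H) : (incl ρ k v : Space ρ) j = 0 := by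
  classical
  simp [incl, lp.single_apply, h]

theorem inner_incl_left (k : Supp ρ) (v : H) (f : Space ρ) : ⟪incl ρ k v, f⟫_ℂ = ⟪v, f k⟫_ℂ := by
  classical
  simp [incl, lp.inner_single_left]

theorem inner_incl_right (k : Supp ρ) (v : H) (f : Space ρ) : ⟪f, incl ρ k v⟫_ℂ = ⟪f k, v⟫_ℂ := by
  classical
  simp [incl, lp.inner_single_right]

theorem norm_incl (k : Supp ρ) (v : H) : ‖incl ρ k v‖ = ‖v‖ := by
  classical
  simp [incl, lp.norm_single]

end Site

/-! ### The density operator and the local states -/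

section Density

variable {Λ H : Type*} [NormedAddCommGroup H] [InnerProductSpace ℂ H] [CompleteSpace H]
  {ρ : Λ → H →L[ℂ] H}

/-- The vectors `√ρₖ eₗ`, which resolve `ρₖ`. -/
def vec (ρ : Λ → H →L[ℂ] H) (k : Λ) (e : basisIndex H) : H := CFC.sqrt (ρ k) (basis H e)

theorem IsBlockDensity.resolves (hρ : IsBlockDensity ρ) (k : Λ) : Resolves (vec ρ k) (ρ k) :=
  resolves_sqrt (hρ.pos k) (hρ.traceClass k)

theorem IsBlockDensity.resolves_siteOp (hρ : IsBlockDensity ρ) (k : Supp ρ) :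
    Resolves (fun e => incl ρ k (vec ρ k e)) (siteOp ρ k k (ρ k)) where
  summable := by
    simp only [norm_incl]
    exact (hρ.resolves k).summable
  hasSum f g := by
    simp only [inner_incl_left, inner_incl_right, siteOp_apply]
    exact (hρ.resolves k).hasSum _ _

theorem IsBlockDensity.trace_eq (hρ : IsBlockDensity ρ) (k : Λ) :
    trace (ρ k) = ((∑' e, ‖vec ρ k e‖ ^ 2 : ℝ) : ℂ) := by
  rw [Complex.ofReal_tsum, (hρ.resolves k).hasSum_norm_sq.tsum_eq]

theorem IsBlockDensity.norm_sq_pos (hρ : IsBlockDensity ρ) (k : Supp ρ) :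
    0 < ∑' e, ‖vec ρ k e‖ ^ 2 := by
  refine lt_of_le_of_ne (tsum_nonneg fun e => by positivity) fun h => k.2 ?_
  have := (hρ.resolves k).norm_le
  rw [← h] at this
  exact norm_le_zero_iff.1 this

theorem IsBlockDensity.hasSum_norm_sq (hρ : IsBlockDensity ρ) :
    HasSum (fun k : Supp ρ => ∑' e, ‖vec ρ k e‖ ^ 2) 1 := by
  have h : HasSum (fun k : Supp ρ => trace (ρ k)) 1 := by
    refine (hasSum_subtype_iff_of_support_subset (s := {i | ρ i ≠ 0})
      (f := fun i => trace (ρ i)) fun i hi => ?_).2 hρ.hasSum_trace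
    intro h0
    exact hi (by simp [h0, trace])
  rw [← Complex.hasSum_ofReal]
  simpa [hρ.trace_eq] using h

theorem IsBlockDensity.hasSum_vec (hρ : IsBlockDensity ρ) :
    HasSum (fun p : Supp ρ × basisIndex H => ‖vec ρ p.1 p.2‖ ^ 2) 1 := by
  have hs := (summable_prod_of_fiber_le
    (g := fun p : Supp ρ × basisIndex H => ‖vec ρ p.1 p.2‖ ^ 2) (fun p => by positivity)
    (fun k => (hρ.resolves k).summable) (fun k => le_rfl) hρ.hasSum_norm_sq.summable).1
  have h := hs.hasSum.prod_fiberwise fun k => (hρ.resolves k).summable.hasSum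
  rw [hρ.hasSum_norm_sq.unique h]
  exact hs.hasSum

theorem IsBlockDensity.resolves_density (hρ : IsBlockDensity ρ) :
    Resolves (fun p : Supp ρ × basisIndex H => incl ρ p.1 (vec ρ p.1 p.2)) (density ρ) where
  summable := by
    simp only [norm_incl]
    exact hρ.hasSum_vec.summable
  hasSum f g := by
    -- Norm convergence, so that the `tsum` in `density` is not the default value `0`.
    have hs : Summable fun k : Supp ρ => siteOp ρ k k (ρ k) := by
      refine Summable.of_norm_bounded hρ.hasSum_norm_sq.summable fun k => ?_
      simpa only [norm_incl] using (hρ.resolves_siteOp k).norm_le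
    have hd : HasSum (fun k : Supp ρ => ⟪g, siteOp ρ k k (ρ k) f⟫_ℂ) ⟪g, density ρ f⟫_ℂ :=
      hs.hasSum.mapL ((innerSL ℂ g) ∘L (ContinuousLinearMap.apply ℂ (Space ρ) f))
    have hG : Summable fun p : Supp ρ × basisIndex H =>
        ⟪g, incl ρ p.1 (vec ρ p.1 p.2)⟫_ℂ * ⟪incl ρ p.1 (vec ρ p.1 p.2), f⟫_ℂ := by
      refine Summable.of_norm_bounded (hρ.hasSum_vec.summable.mul_left (‖g‖ * ‖f‖)) fun p => ?_
      have h1 := norm_inner_le_norm (𝕜 := ℂ) g (incl ρ p.1 (vec ρ p.1 p.2))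
      have h2 := norm_inner_le_norm (𝕜 := ℂ) (incl ρ p.1 (vec ρ p.1 p.2)) f
      rw [norm_incl] at h1 h2
      rw [norm_mul]
      calc _ ≤ (‖g‖ * ‖vec ρ p.1 p.2‖) * (‖vec ρ p.1 p.2‖ * ‖f‖) := by gcongr
        _ = _ := by ring
    have h := hG.hasSum.prod_fiberwise fun k => (hρ.resolves_siteOp k).hasSum f g
    rw [hd.unique h]
    exact hG.hasSum

theorem IsBlockDensity.hasSum_initState (hρ : IsBlockDensity ρ) (x : Space ρ →L[ℂ] Space ρ) :
    HasSum (fun p : Supp ρ × basisIndex H =>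
      ⟪incl ρ p.1 (vec ρ p.1 p.2), x (incl ρ p.1 (vec ρ p.1 p.2))⟫_ℂ) (initState ρ x) :=
  hρ.resolves_density.hasSum_trace x

theorem IsBlockDensity.localState_one (hρ : IsBlockDensity ρ) (k : Supp ρ) :
    localState ρ k 1 = 1 := by
  have h := (hρ.resolves_siteOp k).hasSum_norm_sq
  simp only [norm_incl] at h
  unfold localState
  rw [mul_one, ← h.tsum_eq, (hρ.resolves k).hasSum_norm_sq.tsum_eq, div_self]
  rw [hρ.trace_eq]
  exact_mod_cast (hρ.norm_sq_pos k).ne'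

theorem IsBlockDensity.norm_localState_le (hρ : IsBlockDensity ρ) (k : Supp ρ)
    (x : Space ρ →L[ℂ] Space ρ) : ‖localState ρ k x‖ ≤ ‖x‖ := by
  have h := (hρ.resolves_siteOp k).hasSum_trace x
  have hp := hρ.norm_sq_pos k
  have hb : ‖trace (siteOp ρ k k (ρ k) * x)‖ ≤ ‖x‖ * ∑' e, ‖vec ρ k e‖ ^ 2 := by
    rw [← h.tsum_eq]
    refine tsum_of_norm_bounded ((hρ.resolves k).summable.hasSum.mul_left _) fun e => ?_
    refine (norm_inner_le_norm _ _).trans ?_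
    have := x.le_opNorm (incl ρ k (vec ρ k e))
    rw [norm_incl] at *
    nlinarith [norm_nonneg (vec ρ k e)]
  unfold localState
  rw [norm_div, hρ.trace_eq, Complex.norm_real, Real.norm_of_nonneg hp.le]
  exact (div_le_iff₀ hp).2 hb

end Density

/-! ### The transition expectation -/

section TransExp

variable {Λ H : Type*} [NormedAddCommGroup H] [InnerProductSpace ℂ H] [CompleteSpace H]
  {B : Λ → Λ → H →L[ℂ] H} {ρ : Λ → H →L[ℂ] H}

theorem IsOQRW.hasSum_inner (hB : IsOQRW B) (j : Λ) (u v : H) :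
    HasSum (fun i => ⟪B i j u, B i j v⟫_ℂ) ⟪u, v⟫_ℂ := by
  simpa [ContinuousLinearMap.adjoint_inner_right] using (hB j v).mapL (innerSL ℂ u)

theorem IsOQRW.hasSum_norm_sq (hB : IsOQRW B) (j : Λ) (v : H) :
    HasSum (fun i => ‖B i j v‖ ^ 2) (‖v‖ ^ 2) := by
  rw [← Complex.hasSum_ofReal]
  simpa [inner_self_eq_norm_sq_to_K] using hB.hasSum_inner j v v

theorem IsOQRW.norm_sq_subtype (hB : IsOQRW B) (s : Set Λ) (j : Λ) (v : H) :
    Summable (fun i : s => ‖B i j v‖ ^ 2) ∧ ∑' i : s, ‖B i j v‖ ^ 2 ≤ ‖v‖ ^ 2 := by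
  have h := hB.hasSum_norm_sq j v
  refine ⟨h.summable.subtype s, ?_⟩
  rw [← h.tsum_eq]
  exact h.summable.tsum_subtype_le _ s fun i => by positivity

omit [CompleteSpace H] in
theorem norm_M_apply (i j : Supp ρ) (f : Space ρ) : ‖M B ρ i j f‖ = ‖B i j (f j)‖ := by
  rw [M, siteOp_apply, norm_incl]

/-- For fixed `j`, summing over `i` gives at most `‖f j‖²`, because only supported sites enter; then
sum over `j`. This is the input of `exists_hasSum_sandwich`. -/
theorem IsOQRW.norm_sq_M (hB : IsOQRW B) (f : Space ρ) :
    Summable (fun p : Supp ρ × Supp ρ => ‖M B ρ p.1 p.2 f‖ ^ 2) ∧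
      ∑' p : Supp ρ × Supp ρ, ‖M B ρ p.1 p.2 f‖ ^ 2 ≤ ‖f‖ ^ 2 := by
  have h := summable_prod_of_fiber_le
    (g := fun p : Supp ρ × Supp ρ => ‖B p.2 p.1 (f p.1)‖ ^ 2) (fun p => by positivity)
    (fun j => (hB.norm_sq_subtype {i | ρ i ≠ 0} j (f j)).1)
    (fun j => (hB.norm_sq_subtype {i | ρ i ≠ 0} j (f j)).2) (OQRW.hasSum_norm_sq f).summable
  rw [(OQRW.hasSum_norm_sq f).tsum_eq] at h
  simp only [norm_M_apply]
  exact ⟨(Equiv.prodComm _ _).summable_iff.1 h.1,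
    ((Equiv.prodComm _ _).tsum_eq fun p : Supp ρ × Supp ρ => ‖B p.1 p.2 (f p.2)‖ ^ 2).symm.trans_le
      h.2⟩

theorem exists_hasSum_transTerm (hB : IsOQRW B) (hρ : IsBlockDensity ρ)
    (x y : Space ρ →L[ℂ] Space ρ) :
    ∃ S : Space ρ →L[ℂ] Space ρ, ∀ f, HasSum (fun p => transTerm B ρ x y p f) (S f) := by
  obtain ⟨S, hS⟩ := exists_hasSum_sandwich (A := fun p : Supp ρ × Supp ρ => M B ρ p.1 p.2)
    (t := fun p => localState ρ p.2 x • y) (C := ‖x‖ * ‖y‖) hB.norm_sq_M fun p => by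
      rw [norm_smul]
      gcongr
      exact hρ.norm_localState_le _ _
  refine ⟨S, fun f => (hS f).congr_fun fun p => ?_⟩
  simp [transTerm]

theorem stronglySummable_transTerm (hB : IsOQRW B) (hρ : IsBlockDensity ρ)
    (x y : Space ρ →L[ℂ] Space ρ) : StronglySummable (transTerm B ρ x y) :=
  (exists_hasSum_transTerm hB hρ x y).elim fun _ => stronglySummable_of_hasSum

theorem hasSum_inner_transExp (hB : IsOQRW B) (hρ : IsBlockDensity ρ)
    (x y : Space ρ →L[ℂ] Space ρ) (f g : Space ρ) :
    HasSum (fun p : Supp ρ × Supp ρ => localState ρ p.2 x *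
      ⟪incl ρ p.1 (B p.1 p.2 (g p.2)), y (incl ρ p.1 (B p.1 p.2 (f p.2)))⟫_ℂ)
      ⟪g, transExp B ρ x y f⟫_ℂ := by
  obtain ⟨S, hS⟩ := exists_hasSum_transTerm hB hρ x y
  rw [transExp, strongSum_eq hS]
  refine ((hS f).mapL (innerSL ℂ g)).congr_fun fun p => ?_
  simp [transTerm, ContinuousLinearMap.star_eq_adjoint, ContinuousLinearMap.adjoint_inner_right,
    M, siteOp_apply]

theorem transExp_one_one (hB : IsOQRW B) (hρ : IsBlockDensity ρ)
    (h0 : ∀ i j, ρ i = 0 → ρ j ≠ 0 → B i j = 0) : transExp B ρ 1 1 = 1 := by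
  ext1 f
  refine ext_inner_left ℂ fun g => ?_
  have h := (Equiv.prodComm (Supp ρ) (Supp ρ)).hasSum_iff.2
    (hasSum_inner_transExp hB hρ 1 1 f g)
  refine (h.prod_fiberwise (g := fun j => ⟪g j, f j⟫_ℂ) fun j => ?_).unique (lp.hasSum_inner g f)
  refine ((hasSum_subtype_iff_of_support_subset (s := {i | ρ i ≠ 0})
    (f := fun i => ⟪B i j (g j), B i j (f j)⟫_ℂ) fun i hi hr => hi ?_).2
      (hB.hasSum_inner j (g j) (f j))).congr_fun fun i => ?_
  · simp [h0 i j hr j.2]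
  · simp [hρ.localState_one, inner_incl_left, incl_self]

end TransExp

/-! ### Expansion over paths -/

section Path

variable {Λ H : Type*} [NormedAddCommGroup H] [InnerProductSpace ℂ H]

/-- `pathOp` is defined by splitting off the last step, whereas unfolding the iterated `Ẽ` splits
off the first. -/
theorem pathOp_succ (B : Λ → Λ → H →L[ℂ] H) :
    ∀ (n : ℕ) (i : Fin (n + 2) → Λ),
      pathOp B (n + 1) i = pathOp B n (fun k => i k.succ) * B (i 1) (i 0)
  | 0, i => by simp [pathOp]
  | n + 1, i => by
    rw [pathOp, pathOp_succ B n, pathOp, mul_assoc]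
    rfl

variable [CompleteSpace H] {B : Λ → Λ → H →L[ℂ] H} {ρ : Λ → H →L[ℂ] H}

/-- The path operator along the sites `j, t₀, …, tₙ₋₁`. -/
def consPathOp (B : Λ → Λ → H →L[ℂ] H) {n : ℕ} (j : Supp ρ) (t : Fin n → Supp ρ) : H →L[ℂ] H :=
  pathOp B n fun k => ((Fin.cons j t : Fin (n + 1) → Supp ρ) k : Λ)

omit [CompleteSpace H] in
theorem consPathOp_cons {n : ℕ} (j i : Supp ρ) (t : Fin n → Supp ρ) (v : H) :
    consPathOp B j (Fin.cons i t : Fin (n + 1) → Supp ρ) v = consPathOp B i t (B i j v) := by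
  unfold consPathOp
  rw [pathOp_succ]
  rfl

theorem IsOQRW.norm_sq_consPathOp (hB : IsOQRW B) : ∀ (n : ℕ) (j : Supp ρ) (v : H),
    Summable (fun t : Fin n → Supp ρ => ‖consPathOp B j t v‖ ^ 2) ∧
      ∑' t : Fin n → Supp ρ, ‖consPathOp B j t v‖ ^ 2 ≤ ‖v‖ ^ 2
  | 0, j, v => by
    have h := hasSum_unique fun t : Fin 0 → Supp ρ => ‖consPathOp B j t v‖ ^ 2
    exact ⟨h.summable, by rw [h.tsum_eq]; simp [consPathOp, pathOp]⟩
  | n + 1, j, v => by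
    have h1 := hB.norm_sq_subtype {i | ρ i ≠ 0} j v
    have h := summable_prod_of_fiber_le
      (g := fun p : Supp ρ × (Fin n → Supp ρ) => ‖consPathOp B p.1 p.2 (B p.1 j v)‖ ^ 2)
      (fun p => sq_nonneg _) (fun i => (hB.norm_sq_consPathOp n i (B i j v)).1)
      (fun i => (hB.norm_sq_consPathOp n i (B i j v)).2) h1.1
    rw [← (Fin.consEquiv fun _ => Supp ρ).summable_iff, ← (Fin.consEquiv fun _ => Supp ρ).tsum_eq]
    simp only [Function.comp_def, Fin.consEquiv, Equiv.coe_fn_mk, consPathOp_cons]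
    exact ⟨h.1, h.2.trans h1.2⟩

theorem norm_prod_localState_le (hρ : IsBlockDensity ρ) {n : ℕ}
    (x : Fin n → Space ρ →L[ℂ] Space ρ) (i : Fin n → Supp ρ) :
    ‖∏ k, localState ρ (i k) (x k)‖ ≤ ∏ k, ‖x k‖ := by
  rw [norm_prod]
  exact Finset.prod_le_prod (fun _ _ => norm_nonneg _) fun k _ => hρ.norm_localState_le _ _

/-- Induction on the first step from `j`. The nested sums merge into one over paths because the
terms are dominated by `‖P v‖² ∏ ‖xₖ‖`. -/
theorem hasSum_inner_foldr (hB : IsOQRW B) (hρ : IsBlockDensity ρ) :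
    ∀ (n : ℕ) (x : Fin n → Space ρ →L[ℂ] Space ρ) (j : Supp ρ) (v : H),
      HasSum (fun t : Fin n → Supp ρ => ((‖consPathOp B j t v‖ ^ 2 : ℝ) : ℂ) *
          ∏ k, localState ρ ((Fin.cons j t : Fin (n + 1) → Supp ρ) k.castSucc) (x k))
        ⟪incl ρ j v, (List.ofFn x).foldr (transExp B ρ) 1 (incl ρ j v)⟫_ℂ
  | 0, x, j, v => by
    have h := hasSum_unique fun t : Fin 0 → Supp ρ => ((‖consPathOp B j t v‖ ^ 2 : ℝ) : ℂ) *
          ∏ k, localState ρ ((Fin.cons j t : Fin 1 → Supp ρ) k.castSucc) (x k)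
    convert h using 1
    simp [consPathOp, pathOp, inner_self_eq_norm_sq_to_K, norm_incl]
  | n + 1, x, j, v => by
    let y := (List.ofFn fun k : Fin n => x k.succ).foldr (transExp B ρ) 1
    have hy : (List.ofFn x).foldr (transExp B ρ) 1 = transExp B ρ (x 0) y := by
      rw [List.ofFn_succ, List.foldr_cons]
    have h1 : HasSum (fun i : Supp ρ => localState ρ j (x 0) *
        ⟪incl ρ i (B i j v), y (incl ρ i (B i j v))⟫_ℂ)
        ⟪incl ρ j v, (List.ofFn x).foldr (transExp B ρ) 1 (incl ρ j v)⟫_ℂ := by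
      rw [hy]
      have h := hasSum_inner_transExp hB hρ (x 0) y (incl ρ j v) (incl ρ j v)
      -- Only the pairs `(i, j)` contribute, since `incl ρ j v` vanishes at every other site.
      have hinj : Function.Injective fun i : Supp ρ => (i, j) := fun a b hab =>
        congrArg Prod.fst hab
      rw [← hinj.hasSum_iff] at h
      · simpa only [Function.comp_def, incl_self] using h
      · rintro ⟨i, l⟩ hl
        have : l ≠ j := fun hlj => hl ⟨i, by rw [hlj]⟩
        simp [incl_of_ne this]
    have hG : Summable fun p : Supp ρ × (Fin n → Supp ρ) => localState ρ j (x 0) *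
        (((‖consPathOp B p.1 p.2 (B p.1 j v)‖ ^ 2 : ℝ) : ℂ) *
          ∏ k : Fin n, localState ρ ((Fin.cons p.1 p.2 : Fin (n + 1) → Supp ρ) k.castSucc)
            (x k.succ)) := by
      have hs := (hB.norm_sq_consPathOp (n + 1) j v).1
      rw [← (Fin.consEquiv fun _ => Supp ρ).summable_iff] at hs
      simp only [Function.comp_def, Fin.consEquiv, Equiv.coe_fn_mk, consPathOp_cons] at hs
      refine Summable.mul_left _ (Summable.of_norm_bounded
        (hs.mul_right (∏ k : Fin n, ‖x k.succ‖)) fun p => ?_)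
      rw [norm_mul, Complex.norm_real, Real.norm_of_nonneg (by positivity)]
      gcongr
      exact norm_prod_localState_le hρ _ _
    have h2 := hG.hasSum.prod_fiberwise fun i =>
      (hasSum_inner_foldr hB hρ n (fun k => x k.succ) i (B i j v)).mul_left _
    rw [h1.unique h2, ← (Fin.consEquiv fun _ => Supp ρ).hasSum_iff]
    refine hG.hasSum.congr_fun fun p => ?_
    simp only [Function.comp_def, Fin.consEquiv, Equiv.coe_fn_mk, consPathOp_cons,
      Fin.prod_univ_succ, Fin.castSucc_zero, Fin.cons_zero, Fin.castSucc_succ, Fin.cons_succ]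
    ring

/-- The weight `Tr(P ρ P*)` of a path with path operator `P`. -/
def pathWeight (B : Λ → Λ → H →L[ℂ] H) {n : ℕ} (i : Fin (n + 1) → Supp ρ) : ℝ :=
  ∑' e, ‖pathOp B n (fun k => (i k : Λ)) (vec ρ (i 0) e)‖ ^ 2

theorem hasSum_pathWeight (B : Λ → Λ → H →L[ℂ] H) (hρ : IsBlockDensity ρ) {n : ℕ}
    (i : Fin (n + 1) → Supp ρ) :
    HasSum (fun e => ‖pathOp B n (fun k => (i k : Λ)) (vec ρ (i 0) e)‖ ^ 2) (pathWeight B i) :=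
  ((hρ.resolves (i 0)).map (pathOp B n fun k => (i k : Λ))).summable.hasSum

theorem trace_path (B : Λ → Λ → H →L[ℂ] H) (hρ : IsBlockDensity ρ) {n : ℕ}
    (i : Fin (n + 1) → Supp ρ) :
    trace (pathOp B n (fun k => (i k : Λ)) * ρ (i 0) * star (pathOp B n (fun k => (i k : Λ)))) =
      (pathWeight B i : ℂ) :=
  ((hρ.resolves (i 0)).map (pathOp B n fun k => (i k : Λ))).hasSum_norm_sq.unique
    (Complex.hasSum_ofReal.2 (hasSum_pathWeight B hρ i))

theorem hasSum_initState_foldr (hB : IsOQRW B) (hρ : IsBlockDensity ρ) (n : ℕ)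
    (x : Fin n → Space ρ →L[ℂ] Space ρ) :
    HasSum (fun i : Fin (n + 1) → Supp ρ => (pathWeight B i : ℂ) *
        ∏ k : Fin n, localState ρ (i k.castSucc) (x k))
      (initState ρ ((List.ofFn x).foldr (transExp B ρ) 1)) := by
  have hs := (summable_prod_of_fiber_le
    (g := fun p : (Supp ρ × basisIndex H) × (Fin n → Supp ρ) =>
      ‖consPathOp B p.1.1 p.2 (vec ρ p.1.1 p.1.2)‖ ^ 2) (fun p => sq_nonneg _)
    (fun a => (hB.norm_sq_consPathOp n a.1 (vec ρ a.1 a.2)).1)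
    (fun a => (hB.norm_sq_consPathOp n a.1 (vec ρ a.1 a.2)).2)
    hρ.hasSum_vec.summable).1
  have hG : Summable fun p : (Supp ρ × basisIndex H) × (Fin n → Supp ρ) =>
      ((‖consPathOp B p.1.1 p.2 (vec ρ p.1.1 p.1.2)‖ ^ 2 : ℝ) : ℂ) *
        ∏ k : Fin n, localState ρ ((Fin.cons p.1.1 p.2 : Fin (n + 1) → Supp ρ) k.castSucc)
          (x k) := by
    refine Summable.of_norm_bounded (hs.mul_right (∏ k, ‖x k‖)) fun p => ?_
    rw [norm_mul, Complex.norm_real, Real.norm_of_nonneg (by positivity)]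
    gcongr
    exact norm_prod_localState_le hρ _ _
  have h1 := hG.hasSum.prod_fiberwise fun a =>
    hasSum_inner_foldr hB hρ n x a.1 (vec ρ a.1 a.2)
  rw [(hρ.hasSum_initState _).unique h1]
  -- Regroup so that the basis index is summed first, which produces the path weight.
  let σ : (Supp ρ × (Fin n → Supp ρ)) × basisIndex H ≃
      (Supp ρ × basisIndex H) × (Fin n → Supp ρ) :=
    { toFun := fun p => ((p.1.1, p.2), p.1.2)
      invFun := fun p => ((p.1.1, p.2), p.1.2)
      left_inv := fun _ => rfl
      right_inv := fun _ => rfl }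
  have h2 := σ.hasSum_iff.2 hG.hasSum
  rw [← (Fin.consEquiv fun _ => Supp ρ).hasSum_iff]
  refine h2.prod_fiberwise fun p => ?_
  let i : Fin (n + 1) → Supp ρ := Fin.cons p.1 p.2
  refine ((Complex.hasSum_ofReal.2 (hasSum_pathWeight B hρ i)).mul_right
    (∏ k : Fin n, localState ρ (i k.castSucc) (x k))).congr_fun fun e => ?_
  rfl

theorem hasSum_pathWeight_total (hB : IsOQRW B) (hρ : IsBlockDensity ρ) (n : ℕ) :
    HasSum (fun i : Fin (n + 1) → Supp ρ => (pathWeight B i : ℂ))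
      (initState ρ ((List.ofFn fun _ : Fin n => 1).foldr (transExp B ρ) 1)) := by
  simpa [hρ.localState_one] using hasSum_initState_foldr hB hρ n fun _ => 1

/-! ### Conservation of mass at the last site -/

/-- The path `p` followed by the site `i`. -/
def extend {n : ℕ} (p : Fin (n + 1) → Supp ρ) (i : Supp ρ) : Fin (n + 2) → Supp ρ :=
  Fin.snoc (α := fun _ => Supp ρ) p i

omit [CompleteSpace H] in
theorem extend_castSucc {n : ℕ} (p : Fin (n + 1) → Supp ρ) (i : Supp ρ) (k : Fin (n + 1)) :
    extend p i k.castSucc = p k :=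
  Fin.snoc_castSucc (α := fun _ => Supp ρ) i p k

omit [CompleteSpace H] in
theorem hasSum_extend {n : ℕ} {f : (Fin (n + 2) → Supp ρ) → ℂ} {a : ℂ} (h : HasSum f a) :
    HasSum (fun q : (Fin (n + 1) → Supp ρ) × Supp ρ => f (extend q.1 q.2)) a :=
  ((Equiv.prodComm _ _).trans (Fin.snocEquiv fun _ => Supp ρ)).hasSum_iff.2 h

theorem hasSum_pathWeight_extend (B : Λ → Λ → H →L[ℂ] H) (hρ : IsBlockDensity ρ) {n : ℕ}
    (p : Fin (n + 1) → Supp ρ) (i : Supp ρ) :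
    HasSum (fun e => ‖B i (p (Fin.last n))
      (pathOp B n (fun k => (p k : Λ)) (vec ρ (p 0) e))‖ ^ 2) (pathWeight B (extend p i)) := by
  have h := hasSum_pathWeight B hρ (extend p i)
  have h0 : extend p i 0 = p 0 := extend_castSucc p i 0
  have hl : extend p i (Fin.last (n + 1)) = i := Fin.snoc_last (α := fun _ => Supp ρ) i p
  simpa only [pathOp, h0, hl, extend_castSucc, mul_apply_eq_comp] using h

/-- Summation over the last site does not lose any mass. -/
def Conserves (B : Λ → Λ → H →L[ℂ] H) (ρ : Λ → H →L[ℂ] H) : Prop :=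
  ∀ (n : ℕ) (p : Fin (n + 1) → Supp ρ), HasSum (fun i => pathWeight B (extend p i)) (pathWeight B p)

theorem IsOQRW.norm_sq_family (hB : IsOQRW B) {κ : Type*} (ρ : Λ → H →L[ℂ] H) (j : Λ) {u : κ → H} {a : ℝ}
    (hu : HasSum (fun e => ‖u e‖ ^ 2) a) :
    Summable (fun q : κ × Supp ρ => ‖B q.2 j (u q.1)‖ ^ 2) ∧
      ∑' q : κ × Supp ρ, ‖B q.2 j (u q.1)‖ ^ 2 ≤ a := by
  rw [← hu.tsum_eq]
  exact summable_prod_of_fiber_le (g := fun q : κ × Supp ρ => ‖B q.2 j (u q.1)‖ ^ 2)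
    (fun q => sq_nonneg _) (fun e => (hB.norm_sq_subtype {i | ρ i ≠ 0} j (u e)).1)
    (fun e => (hB.norm_sq_subtype {i | ρ i ≠ 0} j (u e)).2) hu.summable

theorem pathWeight_extend_le (hB : IsOQRW B) (hρ : IsBlockDensity ρ) {n : ℕ}
    (p : Fin (n + 1) → Supp ρ) :
    Summable (fun q : basisIndex H × Supp ρ => ‖B q.2 (p (Fin.last n))
        (pathOp B n (fun k => (p k : Λ)) (vec ρ (p 0) q.1))‖ ^ 2) ∧
      ∑' q : basisIndex H × Supp ρ, ‖B q.2 (p (Fin.last n))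
        (pathOp B n (fun k => (p k : Λ)) (vec ρ (p 0) q.1))‖ ^ 2 ≤ pathWeight B p := by
  have h := hB.norm_sq_family ρ (p (Fin.last n)) (hasSum_pathWeight B hρ p)
  exact ⟨h.1, h.2⟩

theorem hasSum_extend_total (hB : IsOQRW B) (hρ : IsBlockDensity ρ) {n : ℕ}
    (p : Fin (n + 1) → Supp ρ) :
    HasSum (fun i => pathWeight B (extend p i)) (∑' q : basisIndex H × Supp ρ,
      ‖B q.2 (p (Fin.last n)) (pathOp B n (fun k => (p k : Λ)) (vec ρ (p 0) q.1))‖ ^ 2) :=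
  ((Equiv.prodComm _ _).hasSum_iff.2 (pathWeight_extend_le hB hρ p).1.hasSum).prod_fiberwise
    fun i => hasSum_pathWeight_extend B hρ p i

theorem conserves_of_invariant (hB : IsOQRW B) (hρ : IsBlockDensity ρ)
    (h0 : ∀ i j, ρ i = 0 → ρ j ≠ 0 → B i j = 0) : Conserves B ρ := by
  intro n p
  have h1 := (pathWeight_extend_le hB hρ p).1.hasSum.prod_fiberwise fun e =>
    (hasSum_subtype_iff_of_support_subset (s := {i | ρ i ≠ 0})
      (f := fun i => ‖B i (p (Fin.last n))
        (pathOp B n (fun k => (p k : Λ)) (vec ρ (p 0) e))‖ ^ 2) fun i hi hr => hi (by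
          simp [h0 i _ hr (p (Fin.last n)).2])).2 (hB.hasSum_norm_sq _ _)
  rw [(hasSum_pathWeight B hρ p).unique h1]
  exact hasSum_extend_total hB hρ p

theorem IsBlockDensity.initState_one (hρ : IsBlockDensity ρ) : initState ρ 1 = 1 := by
  refine (hρ.hasSum_initState 1).unique ?_
  rw [← Complex.ofReal_one]
  refine (Complex.hasSum_ofReal.2 hρ.hasSum_vec).congr_fun fun p => ?_
  simp [inner_self_eq_norm_sq_to_K, norm_incl]

/-- Paths with `n + 1` and with `n + 2` sites both have total weight `1`, so the nonnegative losses
at the last step sum to zero. -/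
theorem conserves_of_total (hB : IsOQRW B) (hρ : IsBlockDensity ρ)
    (h1 : ∀ n, initState ρ ((List.ofFn fun _ : Fin (n + 1) => 1).foldr (transExp B ρ) 1) = 1) :
    Conserves B ρ := by
  intro n p
  have hA := hasSum_pathWeight_total hB hρ n
  have hC := hasSum_extend (hasSum_pathWeight_total hB hρ (n + 1))
  have hA1 : initState ρ ((List.ofFn fun _ : Fin n => 1).foldr (transExp B ρ) 1) = 1 := by
    -- The hypothesis needs at least one factor; without factors the total is `Tr ρ = 1`.
    cases n with
    | zero =>
      rw [List.ofFn_zero, List.foldr_nil]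
      exact hρ.initState_one
    | succ n => exact h1 n
  rw [h1, ← Complex.ofReal_one, Complex.hasSum_ofReal] at hC
  rw [hA1, ← Complex.ofReal_one, Complex.hasSum_ofReal] at hA
  have hD := hC.prod_fiberwise fun p => hasSum_extend_total hB hρ p
  have hz := (hasSum_zero_iff_of_nonneg fun p =>
    sub_nonneg.2 (pathWeight_extend_le hB hρ p).2).1 (by simpa using hA.sub hD)
  have := congrFun hz p
  simp only [Pi.zero_apply, sub_eq_zero] at this
  rw [this]
  exact hasSum_extend_total hB hρ p

/-- The local states do not involve the last of the `n + 2` sites, so summing it out acts on the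
weight alone. `HasSum` in `ℂ` already means absolute convergence. -/
theorem Conserves.hasSum_pathTerm (hc : Conserves B ρ) (hB : IsOQRW B) (hρ : IsBlockDensity ρ)
    (n : ℕ) (x : Fin (n + 1) → Space ρ →L[ℂ] Space ρ) :
    HasSum (pathTerm B ρ x) (initState ρ (iterExp (transExp B ρ) x)) := by
  have h := hasSum_extend (hasSum_initState_foldr hB hρ (n + 1) x)
  refine h.prod_fiberwise fun p => ?_
  simp only [extend_castSucc, pathTerm, trace_path B hρ p]
  exact (Complex.hasSum_ofReal.2 (hc n p)).mul_right _

theorem elemTensor_one {E : Type*} [NormedAddCommGroup E] [InnerProductSpace ℂ E]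
    [CompleteSpace E] (n : ℕ) :
    elemTensor (fun _ : Fin (n + 1) => (1 : E →L[ℂ] E)) = 1 := by
  refine List.prod_eq_one fun a ha => ?_
  obtain ⟨k, rfl⟩ := (List.mem_ofFn' _ _).1 ha
  exact Subtype.ext (map_one (J E k))

/-- Normalisation of the state, read off at `1 ⊗ ⋯ ⊗ 1`; it supplies the hypothesis of
`conserves_of_total`. -/
theorem IsQMC.apply_iterExp_one {E : Type*} [NormedAddCommGroup E] [InnerProductSpace ℂ E]
    [CompleteSpace E] {φ₀ : (E →L[ℂ] E) → ℂ} {𝓔 : (E →L[ℂ] E) → (E →L[ℂ] E) → (E →L[ℂ] E)}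
    {φ : tensorAlgebra E →ₗ[ℂ] ℂ} (hφ : IsQMC φ₀ 𝓔 φ) (n : ℕ) :
    φ₀ ((List.ofFn fun _ : Fin (n + 1) => 1).foldr 𝓔 1) = 1 := by
  have h := hφ.map_tensor n fun _ => 1
  rw [elemTensor_one, hφ.isState.map_one] at h
  exact h.symm

theorem IsQMC.hasSum_elemTensor {E ι : Type*} [NormedAddCommGroup E] [InnerProductSpace ℂ E]
    [CompleteSpace E] {φ₀ : (E →L[ℂ] E) → ℂ} {𝓔 : (E →L[ℂ] E) → (E →L[ℂ] E) → (E →L[ℂ] E)}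
    {φ : tensorAlgebra E →ₗ[ℂ] ℂ} (hφ : IsQMC φ₀ 𝓔 φ) {n : ℕ} {x : Fin (n + 1) → E →L[ℂ] E}
    {f : ι → ℂ} (h : HasSum f (φ₀ (iterExp 𝓔 x))) : HasSum f (φ (elemTensor x)) := by
  rwa [hφ.map_tensor n x]

end Path

end OQRW

end

theorem mainTheorem6 {Λ H : Type*} [NormedAddCommGroup H] [InnerProductSpace ℂ H]
    [CompleteSpace H] (B : Λ → Λ → H →L[ℂ] H) (hB : OQRW.IsOQRW B)
    (ρ : Λ → H →L[ℂ] H) (hρ : OQRW.IsBlockDensity ρ) :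
    (∀ x y, OQRW.StronglySummable (OQRW.transTerm B ρ x y)) ∧
    ((∀ i j, ρ i = 0 → ρ j ≠ 0 → B i j = 0) →
      OQRW.transExp B ρ 1 1 = 1 ∧
      ∀ (n : ℕ) (x : Fin (n + 1) → OQRW.Space ρ →L[ℂ] OQRW.Space ρ),
        HasSum (OQRW.pathTerm B ρ x)
          (OQRW.initState ρ (OQRW.iterExp (OQRW.transExp B ρ) x))) ∧
    ∀ φ : OQRW.tensorAlgebra (OQRW.Space ρ) →ₗ[ℂ] ℂ,
      OQRW.IsQMC (OQRW.initState ρ) (OQRW.transExp B ρ) φ →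
      ∀ (n : ℕ) (x : Fin (n + 1) → OQRW.Space ρ →L[ℂ] OQRW.Space ρ),
        HasSum (OQRW.pathTerm B ρ x) (φ (OQRW.elemTensor x)) := by
  exact ⟨OQRW.stronglySummable_transTerm hB hρ, fun h0 =>
    ⟨OQRW.transExp_one_one hB hρ h0, (OQRW.conserves_of_invariant hB hρ h0).hasSum_pathTerm hB hρ⟩,
    fun φ hφ n x => hφ.hasSum_elemTensor
      ((OQRW.conserves_of_total hB hρ hφ.apply_iterExp_one).hasSum_pathTerm hB hρ n x)⟩
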